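/- Let $(\mathfrak F,d)$ be a separable metric space with its Borel $\sigma$-algebra, let $\mathcal P$ be the set of all Borel probability measures on $\mathfrak F$, and let $d_{\mathcal P}$ and $d_{\mathcal P(\mathbb R)}$ be metrics (for example the Prohorov metrics) that metrise the topology of weak convergence on $\mathcal P$ and on the set $\mathcal P(\mathbb R)$ of all Borel probability measures on $\mathbb R$, respectively. Let $D:\mathfrak F\times\mathcal P\to\mathbb R$ be a mapping (a depth) that is continuous in $P$: for all $x\in\mathfrak F$, all $P\in\mathcal P$ and every $\epsilon>0$ there exists $\delta>0$ such that $|D(x,Q)-D(x,P)|<\epsilon$ for all $Q\in\mathcal P$ with $d_{\mathcal P}(Q,P)<\delta$. For $n\ge 1$ and $P\in\mathcal P$ let $P_n=\frac1n\sum_{i=1}^n\delta_{X_i}$ be the empirical measure of $n$ independent random draws $X_1,\dots,X_n$ from $P$, and let $\mathcal L_P(D(x,P_n))$ be the law on $\mathbb R$ of the empirical depth $D(x,P_n)$. Then for every $x\in\mathfrak F$ and every $P\in\mathcal P$ the empirical depth is qualitatively robust at $P$ in Hampel's sense: $D(x,P_n)$ is a (measurable) random variable for every $n\geq 1$, and for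 all $\epsilon>0$ there exists $\delta>0$ such that for every $Q\in\mathcal P$ with $d_{\mathcal P}(Q,P)<\delta$, $$d_{\mathcal P(\mathbb R)}\bigl(\mathcal L_P(D(x,P_n)),\,\mathcal L_Q(D(x,Q_n))\bigr)<\epsilon\quad\text{for all } n\ge 1,$$ where $Q_n$ is the empirical measure of $n$ independent random draws from $Q$. -/

import Mathlib

open MeasureTheory Topology Filter
open scoped ENNReal

noncomputable section

namespace FunctionalDepth

/-- `d` is a metric on the set of all Borel probability measures on `S`, and it metrises the
topology of weak convergence (the topology that Mathlib puts on `ProbabilityMeasure S`): the open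
`d`-balls centred at `μ` form a neighbourhood basis of `μ` in that topology. -/
structure MetrizesWeakConvergence {S : Type*} [TopologicalSpace S] [MeasurableSpace S]
    [OpensMeasurableSpace S] (d : ProbabilityMeasure S → ProbabilityMeasure S → ℝ) : Prop where
  eq_zero_iff : ∀ μ ν, d μ ν = 0 ↔ μ = ν
  symm : ∀ μ ν, d μ ν = d ν μ
  triangle : ∀ μ ν κ, d μ κ ≤ d μ ν + d ν κ
  nhds_basis : ∀ μ, (𝓝 μ).HasBasis (fun r : ℝ => 0 < r) (fun r => {ν | d ν μ < r})

section

variable {𝓕 : Type*} [MeasurableSpace 𝓕]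

/-- Continuity in `P` of a mapping `D : 𝓕 × 𝓟 → ℝ`, where `𝓟` is the set of all probability
measures on `𝓕`, with the metric `d`: for every point `x`, every `P` and every `ε > 0` there is
`δ > 0` such that `|D(x, Q) - D(x, P)| < ε` for all `Q` with `d(Q, P) < δ`. -/
def ContinuousInP (d : ProbabilityMeasure 𝓕 → ProbabilityMeasure 𝓕 → ℝ)
    (D : 𝓕 → ProbabilityMeasure 𝓕 → ℝ) : Prop :=
  ∀ (x : 𝓕) (P : ProbabilityMeasure 𝓕), ∀ ε > 0, ∃ δ > 0,
    ∀ Q : ProbabilityMeasure 𝓕, d Q P < δ → |D x Q - D x P| < ε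

/-- The empirical measure of a sample of size `n ≥ 1`: point masses of weight `1 / n` at the
sample points `X 0, …, X (n - 1)`. -/
def empiricalMeasure {n : ℕ} [NeZero n] (X : Fin n → 𝓕) : ProbabilityMeasure 𝓕 :=
  ⟨(n : ℝ≥0∞)⁻¹ • ∑ i, Measure.dirac (X i), ⟨by
    simp [ENNReal.inv_mul_cancel (Nat.cast_ne_zero.2 (NeZero.ne n)) (ENNReal.natCast_ne_top n)]⟩⟩

/-- The empirical depth of `x` as a function of the sample `X`. -/
def empiricalDepth (D : 𝓕 → ProbabilityMeasure 𝓕 → ℝ) (x : 𝓕) (n : ℕ) [NeZero n]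
    (X : Fin n → 𝓕) : ℝ :=
  D x (empiricalMeasure X)

/-- The law on `ℝ` of the empirical depth of `x` when the sample consists of `n` independent draws
from `P`, that is, when the sample has law `P × ⋯ × P`. The argument `h` says that the empirical
depth is a random variable. -/
def lawEmpiricalDepth (D : 𝓕 → ProbabilityMeasure 𝓕 → ℝ) (x : 𝓕) (n : ℕ) [NeZero n]
    (h : Measurable (empiricalDepth D x n)) (P : ProbabilityMeasure 𝓕) : ProbabilityMeasure ℝ :=
  (ProbabilityMeasure.pi fun _ : Fin n => P).map h.aemeasurable

/-- Qualitative robustness at `P` of the empirical depth of `x`: the empirical depth is a random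
variable for every sample size, and for all `ε > 0` there is `δ > 0` such that, for every
probability measure `Q` with `d(Q, P) < δ`, the laws of the empirical depth under sampling from `P`
and under sampling from `Q` are at `d'`-distance less than `ε`, for all sample sizes `n ≥ 1`. Here
`d` and `d'` are metrics on the probability measures on `𝓕` and on `ℝ`. -/
def QualitativelyRobustAt (d : ProbabilityMeasure 𝓕 → ProbabilityMeasure 𝓕 → ℝ)
    (d' : ProbabilityMeasure ℝ → ProbabilityMeasure ℝ → ℝ)
    (D : 𝓕 → ProbabilityMeasure 𝓕 → ℝ) (x : 𝓕) (P : ProbabilityMeasure 𝓕) : Prop :=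
  ∃ h : ∀ (n : ℕ) [NeZero n], Measurable (empiricalDepth D x n),
    ∀ ε > 0, ∃ δ > 0, ∀ Q : ProbabilityMeasure 𝓕, d Q P < δ → ∀ (n : ℕ) [NeZero n],
      d' (lawEmpiricalDepth D x n (h n) P) (lawEmpiricalDepth D x n (h n) Q) < ε

end

end FunctionalDepth

end

/-!
The space of probability measures carries the topology of weak convergence, and in these terms the
theorem follows from two facts about the law `ℒ_n(Q)` of `D(x, Q_n)`, where `Q_n` is the empirical
measure of `n` draws from `Q`.

* For fixed `n`, the map `Q ↦ ℒ_n(Q)` is continuous, because `Q ↦ Q^n` is weakly continuous on a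
  second countable space and `ℒ_n(Q)` is the image of `Q^n` under `X ↦ D(x, empiricalMeasure X)`,
  which is continuous (`continuous_empiricalMeasure`), hence also measurable.
* As `Q → P` and `n → ∞` jointly, `ℒ_n(Q)` converges to the point mass at `D(x, P)`
  (`tendsto_lawEmpiricalDepth`). This is a law of large numbers that is locally uniform in the
  sampled measure: for bounded continuous `f`, Chebyshev's inequality bounds the probability that
  `∫ f dQ_n` and `∫ f dQ` differ by `e` or more by `‖f‖² / (n e²)`, whatever `Q` is
  (`pi_abs_integral_empiricalMeasure_sub_ge_le`), and `∫ f dQ → ∫ f dP`.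

The second fact controls all `n ≥ N` simultaneously on a neighbourhood of `P`; the first one
controls each of the finitely many remaining `n`.
-/

open MeasureTheory Topology Filter ProbabilityTheory
open scoped ENNReal BoundedContinuousFunction

namespace FunctionalDepth

variable {S : Type*} [MeasurableSpace S]

/-! ### Metrics for weak convergence -/

lemma MetrizesWeakConvergence.continuous_of_continuousInP [TopologicalSpace S]
    [OpensMeasurableSpace S] {d : ProbabilityMeasure S → ProbabilityMeasure S → ℝ}
    (hd : MetrizesWeakConvergence d) {D : S → ProbabilityMeasure S → ℝ}
    (hD : ContinuousInP d D) (x : S) : Continuous (D x) := by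
  refine continuous_iff_continuousAt.2 fun P ↦ ?_
  refine ((hd.nhds_basis P).tendsto_iff Metric.nhds_basis_ball).2 fun ε hε ↦ ?_
  obtain ⟨δ, hδ, h⟩ := hD x P ε hε
  exact ⟨δ, hδ, fun Q hQ ↦ h Q hQ⟩

/-! ### Empirical measures -/

lemma integral_empiricalMeasure {n : ℕ} [NeZero n] (X : Fin n → S) {f : S → ℝ}
    (hf : StronglyMeasurable f) :
    ∫ s, f s ∂(empiricalMeasure X : Measure S) = (n : ℝ)⁻¹ * ∑ i, f (X i) := by
  change ∫ s, f s ∂((n : ℝ≥0∞)⁻¹ • ∑ i, Measure.dirac (X i)) = _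
  rw [integral_smul_measure, integral_finsetSum_measure]
  · simp [integral_dirac' _ _ hf]
  · exact fun i _ ↦ integrable_dirac' hf (by simp)

lemma continuous_empiricalMeasure [TopologicalSpace S] [OpensMeasurableSpace S] (n : ℕ) [NeZero n] :
    Continuous (empiricalMeasure : (Fin n → S) → ProbabilityMeasure S) := by
  refine continuous_iff_continuousAt.2 fun X ↦ ?_
  refine ProbabilityMeasure.tendsto_iff_forall_integral_tendsto.2 fun f ↦ ?_
  simp_rw [integral_empiricalMeasure _ f.continuous.stronglyMeasurable]
  exact Continuous.tendsto (by fun_prop) X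

/-! ### The law of large numbers, locally uniformly in the sampled measure -/

/-- Chebyshev's inequality for the empirical mean of a bounded function. The bound does not depend
on the sampled measure. -/
lemma pi_abs_integral_empiricalMeasure_sub_ge_le [TopologicalSpace S] [OpensMeasurableSpace S]
    (n : ℕ) [NeZero n] (Q : ProbabilityMeasure S) (f : S →ᵇ ℝ) {e : ℝ} (he : 0 < e) :
    Measure.pi (fun _ : Fin n ↦ (Q : Measure S))
        {X | e ≤ |∫ s, f s ∂(empiricalMeasure X : Measure S) - ∫ s, f s ∂(Q : Measure S)|}
      ≤ ENNReal.ofReal (‖f‖ ^ 2 / n / e ^ 2) := by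
  have hn : (n : ℝ) ≠ 0 := Nat.cast_ne_zero.2 (NeZero.ne n)
  have hf : StronglyMeasurable f := f.continuous.stronglyMeasurable
  have hf2 : MemLp f 2 (Q : Measure S) :=
    MemLp.of_bound hf.aestronglyMeasurable ‖f‖ (ae_of_all _ f.norm_coe_le_norm)
  have heval (i : Fin n) : MemLp (fun X : Fin n → S ↦ f (X i)) 2
      (Measure.pi fun _ : Fin n ↦ (Q : Measure S)) :=
    hf2.comp_measurePreserving (measurePreserving_eval _ i)
  have hmean : MemLp (fun X : Fin n → S ↦ (n : ℝ)⁻¹ * ∑ i, f (X i)) 2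
      (Measure.pi fun _ : Fin n ↦ (Q : Measure S)) :=
    (memLp_finsetSum _ fun i _ ↦ heval i).const_mul _
  have hexp : ∫ X, (n : ℝ)⁻¹ * ∑ i, f (X i) ∂(Measure.pi fun _ : Fin n ↦ (Q : Measure S))
      = ∫ s, f s ∂(Q : Measure S) := by
    rw [integral_const_mul, integral_finsetSum _ fun i _ ↦ (heval i).integrable (by norm_num)]
    have (i : Fin n) : ∫ X, f (X i) ∂(Measure.pi fun _ : Fin n ↦ (Q : Measure S))
        = ∫ s, f s ∂(Q : Measure S) := integral_comp_eval hf.aestronglyMeasurable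
    simp [this, hn]
  have hvar : Var[fun X ↦ (n : ℝ)⁻¹ * ∑ i, f (X i); Measure.pi fun _ : Fin n ↦ (Q : Measure S)]
      ≤ ‖f‖ ^ 2 / n := by
    have hsum : Var[fun X ↦ ∑ i, f (X i); Measure.pi fun _ : Fin n ↦ (Q : Measure S)]
        = ∑ _ : Fin n, Var[f; (Q : Measure S)] := by
      rw [← variance_sum_pi fun _ ↦ hf2, Finset.sum_fn]
    have hle : Var[f; (Q : Measure S)] ≤ ‖f‖ ^ 2 := by
      refine (variance_le_sq_of_bounded (a := -‖f‖) (b := ‖f‖) (ae_of_all _ fun s ↦ ?_)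
        hf.measurable.aemeasurable).trans_eq (by ring)
      exact abs_le.1 (f.norm_coe_le_norm s)
    rw [variance_const_mul, hsum, Finset.sum_const, Finset.card_univ, Fintype.card_fin, nsmul_eq_mul]
    calc ((n : ℝ)⁻¹) ^ 2 * (n * Var[f; (Q : Measure S)])
        = Var[f; (Q : Measure S)] / n := by field_simp
      _ ≤ _ := by gcongr
  simp_rw [integral_empiricalMeasure _ hf, ← hexp]
  refine (meas_ge_le_variance_div_sq hmean he).trans ?_
  gcongr

/-- The empirical measure of a sample from `Q` is in any given neighbourhood of `P` with probability
tending to `1` as `Q → P` and the sample size tends to infinity. -/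
lemma tendsto_pi_empiricalMeasure_notMem [TopologicalSpace S] [OpensMeasurableSpace S]
    {P : ProbabilityMeasure S} {U : Set (ProbabilityMeasure S)} (hU : U ∈ 𝓝 P) :
    Tendsto (fun p : ProbabilityMeasure S × ℕ ↦
        Measure.pi (fun _ : Fin (p.2 + 1) ↦ (p.1 : Measure S)) {X | empiricalMeasure X ∉ U})
      (𝓝 P ×ˢ atTop) (𝓝 0) := by
  -- The sets `U` with the claimed property form a filter `F`. Convergence of `F` to `P` may be
  -- tested against one bounded continuous function at a time.
  let F : Filter (ProbabilityMeasure S) :=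
    { sets := {U | Tendsto (fun p : ProbabilityMeasure S × ℕ ↦
        Measure.pi (fun _ : Fin (p.2 + 1) ↦ (p.1 : Measure S)) {X | empiricalMeasure X ∉ U})
        (𝓝 P ×ˢ atTop) (𝓝 0)}
      univ_sets := by simp
      sets_of_superset := fun {U V} hU hUV ↦
        tendsto_of_tendsto_of_tendsto_of_le_of_le tendsto_const_nhds hU (fun _ ↦ zero_le)
          fun p ↦ measure_mono fun X hX hXU ↦ hX (hUV hXU)
      inter_sets := fun {U V} hU hV ↦ by
        refine tendsto_of_tendsto_of_tendsto_of_le_of_le tendsto_const_nhds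
          (by simpa using Tendsto.add hU hV) (fun _ ↦ zero_le) fun p ↦ ?_
        refine (measure_mono fun X hX ↦ ?_).trans (measure_union_le _ _)
        simpa [Set.mem_inter_iff, imp_iff_not_or] using hX }
  suffices h : Tendsto id F (𝓝 P) from h hU
  refine ProbabilityMeasure.tendsto_iff_forall_integral_tendsto.2 fun f ↦ ?_
  refine (Metric.nhds_basis_ball.tendsto_right_iff).2 fun e he ↦ ?_
  change Tendsto (fun p : ProbabilityMeasure S × ℕ ↦
    Measure.pi (fun _ : Fin (p.2 + 1) ↦ (p.1 : Measure S)) {X | ¬ |∫ s, f s ∂(empiricalMeasure X :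
      Measure S) - ∫ s, f s ∂(P : Measure S)| < e}) (𝓝 P ×ˢ atTop) (𝓝 0)
  have hbound : Tendsto (fun p : ProbabilityMeasure S × ℕ ↦
      ENNReal.ofReal (‖f‖ ^ 2 / ((p.2 + 1 : ℕ) : ℝ) / (e / 2) ^ 2)) (𝓝 P ×ˢ atTop) (𝓝 0) := by
    have h := (tendsto_const_div_atTop_nhds_zero_nat (‖f‖ ^ 2)).comp
      ((tendsto_add_atTop_nat 1).comp (tendsto_snd (f := 𝓝 P)))
    simpa using ENNReal.tendsto_ofReal (h.div_const ((e / 2) ^ 2))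
  have hmean : ∀ᶠ p : ProbabilityMeasure S × ℕ in 𝓝 P ×ˢ atTop,
      |∫ s, f s ∂(p.1 : Measure S) - ∫ s, f s ∂(P : Measure S)| < e / 2 :=
    tendsto_fst.eventually ((ProbabilityMeasure.tendsto_iff_forall_integral_tendsto.1
      (tendsto_id (x := 𝓝 P)) f).eventually (Metric.ball_mem_nhds _ (half_pos he)))
  refine tendsto_of_tendsto_of_tendsto_of_le_of_le' tendsto_const_nhds hbound
    (Eventually.of_forall fun _ ↦ zero_le) ?_
  filter_upwards [hmean] with p hp
  refine (measure_mono fun X hX ↦ ?_).trans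
    (pi_abs_integral_empiricalMeasure_sub_ge_le (p.2 + 1) p.1 f (half_pos he))
  have htri := abs_sub_le (∫ s, f s ∂(empiricalMeasure X : Measure S))
    (∫ s, f s ∂(p.1 : Measure S)) (∫ s, f s ∂(P : Measure S))
  have hXe := not_lt.1 hX
  change e / 2 ≤ _
  linarith

/-! ### The law of the empirical depth -/

lemma continuous_empiricalDepth [TopologicalSpace S] [OpensMeasurableSpace S]
    {D : S → ProbabilityMeasure S → ℝ} {x : S} (hD : Continuous (D x)) (n : ℕ) [NeZero n] :
    Continuous (empiricalDepth D x n) :=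
  hD.comp (continuous_empiricalMeasure n)

lemma integral_lawEmpiricalDepth {D : S → ProbabilityMeasure S → ℝ} {x : S} {n : ℕ} [NeZero n]
    (h : Measurable (empiricalDepth D x n)) (Q : ProbabilityMeasure S) (g : ℝ →ᵇ ℝ) :
    ∫ t, g t ∂(lawEmpiricalDepth D x n h Q : Measure ℝ)
      = ∫ X, g (empiricalDepth D x n X) ∂(Measure.pi fun _ : Fin n ↦ (Q : Measure S)) :=
  integral_map h.aemeasurable g.continuous.aestronglyMeasurable

lemma continuous_lawEmpiricalDepth [TopologicalSpace S] [SecondCountableTopology S]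
    [TopologicalSpace.PseudoMetrizableSpace S] [BorelSpace S]
    {D : S → ProbabilityMeasure S → ℝ} {x : S} (hD : Continuous (D x)) (n : ℕ) [NeZero n]
    (h : Measurable (empiricalDepth D x n)) : Continuous (lawEmpiricalDepth D x n h) :=
  (ProbabilityMeasure.continuous_map (continuous_empiricalDepth hD n)).comp
    (ProbabilityMeasure.continuous_pi.comp (by fun_prop))

/-- The law of the empirical depth under `Q` converges to the point mass at the depth under `P`,
as `Q → P` and the sample size tends to infinity. -/
lemma tendsto_lawEmpiricalDepth [TopologicalSpace S] [OpensMeasurableSpace S]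
    {D : S → ProbabilityMeasure S → ℝ} {x : S} (hD : Continuous (D x))
    (h : ∀ n : ℕ, Measurable (empiricalDepth D x (n + 1))) (P : ProbabilityMeasure S) :
    Tendsto (fun p : ProbabilityMeasure S × ℕ ↦ lawEmpiricalDepth D x (p.2 + 1) (h p.2) p.1)
      (𝓝 P ×ˢ atTop) (𝓝 (diracProba (D x P))) := by
  refine ProbabilityMeasure.tendsto_iff_forall_integral_tendsto.2 fun g ↦ ?_
  simp_rw [integral_lawEmpiricalDepth]
  change Tendsto _ _ (𝓝 (∫ t, g t ∂(Measure.dirac (D x P))))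
  rw [integral_dirac, Metric.tendsto_nhds]
  intro e he
  -- `g (D x R)` is within `e / 2` of `g (D x P)` for `R ∈ U`, and within `2 * ‖g‖` in any case.
  let U : Set (ProbabilityMeasure S) := {R | |g (D x R) - g (D x P)| < e / 2}
  have hU : U ∈ 𝓝 P :=
    (g.continuous.comp hD).continuousAt.eventually (Metric.ball_mem_nhds _ (half_pos he))
  have hsmall := (ENNReal.tendsto_toReal ENNReal.zero_ne_top).comp
    (tendsto_pi_empiricalMeasure_notMem hU)
  have hsmall' := (hsmall.const_mul (2 * ‖g‖)).eventually_lt_const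
    (u := e / 2) (by simpa using he)
  filter_upwards [hsmall'] with p hp
  set μ := Measure.pi fun _ : Fin (p.2 + 1) ↦ (p.1 : Measure S)
  set A : Set (Fin (p.2 + 1) → S) := {X | empiricalMeasure X ∉ U}
  have hmeas : Measurable fun X ↦ g (empiricalDepth D x (p.2 + 1) X) :=
    g.continuous.measurable.comp (h p.2)
  have hA : MeasurableSet A := by
    have : A = {X | e / 2 ≤ |g (empiricalDepth D x (p.2 + 1) X) - g (D x P)|} := by
      ext X
      exact not_lt (α := ℝ)
    rw [this]
    exact measurableSet_le measurable_const (by fun_prop)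
  have hint : Integrable (fun X ↦ g (empiricalDepth D x (p.2 + 1) X)) μ :=
    Integrable.of_bound hmeas.aestronglyMeasurable ‖g‖
      (ae_of_all _ fun X ↦ g.norm_coe_le_norm _)
  have hintA : Integrable (fun X ↦ e / 2 + A.indicator (fun _ ↦ 2 * ‖g‖) X) μ :=
    (integrable_const _).add ((integrable_const _).indicator hA)
  have hle (X : Fin (p.2 + 1) → S) :
      ‖g (empiricalDepth D x (p.2 + 1) X) - g (D x P)‖
        ≤ e / 2 + A.indicator (fun _ ↦ 2 * ‖g‖) X := by
    by_cases hX : X ∈ A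
    · rw [Set.indicator_of_mem hX]
      have := norm_sub_le (g (empiricalDepth D x (p.2 + 1) X)) (g (D x P))
      have h1 := g.norm_coe_le_norm (empiricalDepth D x (p.2 + 1) X)
      have h2 := g.norm_coe_le_norm (D x P)
      linarith
    · rw [Set.indicator_of_notMem hX, add_zero]
      have hXU : empiricalMeasure X ∈ U := not_not.1 hX
      exact le_of_lt hXU
  calc dist (∫ X, g (empiricalDepth D x (p.2 + 1) X) ∂μ) (g (D x P))
      = ‖∫ X, (g (empiricalDepth D x (p.2 + 1) X) - g (D x P)) ∂μ‖ := by
        rw [integral_sub hint (integrable_const _), integral_const, dist_eq_norm]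
        simp
    _ ≤ ∫ X, (e / 2 + A.indicator (fun _ ↦ 2 * ‖g‖) X) ∂μ :=
        norm_integral_le_of_norm_le hintA (ae_of_all _ hle)
    _ = e / 2 + 2 * ‖g‖ * (μ A).toReal := by
        rw [integral_add (integrable_const _) ((integrable_const _).indicator hA),
          integral_indicator_const _ hA, integral_const]
        simp [measureReal_def, mul_comm]
    _ < e := by
        have : 2 * ‖g‖ * (μ A).toReal < e / 2 := hp
        linarith

end FunctionalDepth

open FunctionalDepth in
theorem mainTheorem3 {𝓕 : Type*} [MetricSpace 𝓕] [TopologicalSpace.SeparableSpace 𝓕]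
    [MeasurableSpace 𝓕] [BorelSpace 𝓕]
    (d : MeasureTheory.ProbabilityMeasure 𝓕 → MeasureTheory.ProbabilityMeasure 𝓕 → ℝ)
    (hd : FunctionalDepth.MetrizesWeakConvergence d)
    (d' : MeasureTheory.ProbabilityMeasure ℝ → MeasureTheory.ProbabilityMeasure ℝ → ℝ)
    (hd' : FunctionalDepth.MetrizesWeakConvergence d')
    (D : 𝓕 → MeasureTheory.ProbabilityMeasure 𝓕 → ℝ)
    (hD : FunctionalDepth.ContinuousInP d D) :
    ∀ (x : 𝓕) (P : MeasureTheory.ProbabilityMeasure 𝓕),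
      FunctionalDepth.QualitativelyRobustAt d d' D x P := by
  intro x P
  have : SecondCountableTopology 𝓕 := UniformSpace.secondCountable_of_separable 𝓕
  have hDx : Continuous (D x) := hd.continuous_of_continuousInP hD x
  refine ⟨fun n _ ↦ (continuous_empiricalDepth hDx n).measurable, fun ε hε ↦ ?_⟩
  have hmeas (n : ℕ) : Measurable (empiricalDepth D x (n + 1)) :=
    (continuous_empiricalDepth hDx (n + 1)).measurable
  -- Large samples: the laws under `P` and `Q` are both close to the point mass at `D x P`.
  obtain ⟨p, hp, q, hq, hpq⟩ := eventually_prod_iff.1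
    ((tendsto_lawEmpiricalDepth hDx hmeas P).eventually
      ((hd'.nhds_basis _).mem_of_mem (half_pos hε)))
  obtain ⟨N, hN⟩ := eventually_atTop.1 hq
  -- Small samples: each of the finitely many laws depends continuously on `Q`.
  have hfin : ∀ᶠ Q in 𝓝 P, ∀ n ∈ Finset.range N,
      d' (lawEmpiricalDepth D x (n + 1) (hmeas n) Q)
        (lawEmpiricalDepth D x (n + 1) (hmeas n) P) < ε :=
    (Finset.eventually_all _).2 fun n _ ↦
      (continuous_lawEmpiricalDepth hDx (n + 1) (hmeas n)).continuousAt.eventually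
        ((hd'.nhds_basis _).mem_of_mem hε)
  obtain ⟨δ, hδ, hball⟩ := (hd.nhds_basis P).eventually_iff.1 (hp.and hfin)
  refine ⟨δ, hδ, fun Q hQ n hn ↦ ?_⟩
  obtain ⟨m, rfl⟩ := Nat.exists_eq_succ_of_ne_zero hn.out
  obtain ⟨hpQ, hfinQ⟩ := hball hQ
  rcases lt_or_ge m N with hm | hm
  · rw [hd'.symm]
    exact hfinQ m (Finset.mem_range.2 hm)
  · calc d' (lawEmpiricalDepth D x (m + 1) (hmeas m) P) (lawEmpiricalDepth D x (m + 1) (hmeas m) Q)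
        ≤ d' (lawEmpiricalDepth D x (m + 1) (hmeas m) P) (diracProba (D x P))
          + d' (diracProba (D x P)) (lawEmpiricalDepth D x (m + 1) (hmeas m) Q) :=
        hd'.triangle _ _ _
      _ = d' (lawEmpiricalDepth D x (m + 1) (hmeas m) P) (diracProba (D x P))
          + d' (lawEmpiricalDepth D x (m + 1) (hmeas m) Q) (diracProba (D x P)) := by
        rw [hd'.symm (diracProba _)]
      _ < ε / 2 + ε / 2 := add_lt_add (hpq hp.self_of_nhds (hN m hm)) (hpq hpQ (hN m hm))
      _ = ε := add_halves ε
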